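/- For $z\in\mathbb C$ and $t\ge 0$ let $\overline D_z(t)$ be the closed disc with centre $z$ and radius $t$, and put $\overline D(t)=\overline D_0(t)$. Let $r>0$ and let $\mu$ be a (positive, possibly infinite) Borel measure on $\overline D(r)\subset\mathbb C$, extended by zero to $\mathbb C$. For $z\in\mathbb C$ and $s>0$ put $$\mathsf N_z^{\mu}(s)=\int_0^s\frac{\mu(\overline D_z(t))}{t}\,dt\in[0,+\infty].$$ A meromorphic function on $\overline D(R)$ is a function meromorphic in a neighbourhood of $\overline D(R)$, not identically $\infty$; the function $\ln^+|f|$ takes the value $+\infty$ at the poles of $f$. Let $n(t,f)$ be the number of poles of $f$ in $\overline D(t)$, counted with multiplicity, and put $$N(t,f)=\int_0^t\frac{n(s,f)-n(0,f)}{s}\,ds+n(0,f)\ln t,\qquad T(R,f)=\frac1{2\pi}\int_0^{2\pi}\ln^+|f(Re^{i\theta})|\,d\theta+N(R,f).$$ Then the following two statements are equivalent. (I) There exist $r_0>0$ and $R>r$ such that $\sup_{z\in\overline D(R)}\mathsf N_z^{\mu}(r_0)<+\infty$. (II) For every $R>r$ and every meromorphic function $f$ on $\overline D(R)$, the function $\ln^+|f|$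 is $\mu$-summable (measurable with finite integral) and $$\int_{\overline D(r)}\ln^+|f|\,d\mu\le 5\,\frac{R+r}{R-r}\,\bigl(T(R,f)-N(r,f)\bigr)\Bigl(\mu(\overline D(r))+\sup_{z\in\overline D(R)}\mathsf N_z^{\mu}(r)\Bigr)<+\infty.$$ (Here $0\cdot\infty=0$, which matters only if $T(R,f)=N(r,f)$.) -/

import Mathlib

open MeasureTheory Metric
open scoped ENNReal

noncomputable section

namespace Nevanlinna

/-- The integrated radial counting function `N_z^μ(r) = ∫₀^r μ(D̄_z(t)) / t dt ∈ [0, ∞]` of a Borel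
measure `μ` on the complex plane. -/
def measureCounting (μ : Measure ℂ) (z : ℂ) (r : ℝ) : ℝ≥0∞ :=
  ∫⁻ t in Set.Ioc 0 r, μ (closedBall z t) / ENNReal.ofReal t

/-- The multiplicity of `z` as a pole of `f`; it is `0` if `z` is not a pole. -/
def poleMultiplicity (f : ℂ → ℂ) (z : ℂ) : ℕ :=
  (-(meromorphicOrderAt f z).untop₀).toNat

/-- `n(t, f)`: the number of poles of `f` in the closed disc of radius `t` centred at `0`, counted
with multiplicity. -/
def poleCount (t : ℝ) (f : ℂ → ℂ) : ℕ :=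
  ∑ᶠ z ∈ closedBall (0 : ℂ) t, poleMultiplicity f z

/-- `N(r, f) = ∫₀^r (n(t, f) - n(0, f)) / t dt + n(0, f) ln r`. -/
def poleCounting (r : ℝ) (f : ℂ → ℂ) : ℝ :=
  (∫ t in (0 : ℝ)..r, ((poleCount t f : ℝ) - (poleCount 0 f : ℝ)) / t)
    + (poleCount 0 f : ℝ) * Real.log r

/-- `T(R, f) = m(R, f) + N(R, f)`, where `m(R, f)` is the mean of `ln⁺|f|` over the circle of
radius `R` centred at `0`. -/
def nevanlinnaT (R : ℝ) (f : ℂ → ℂ) : ℝ :=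
  Real.circleAverage (fun z => Real.posLog ‖f z‖) 0 R + poleCounting R f

open Classical in
/-- `ln⁺|f|` as a function with values in `[0, ∞]`: it is `∞` at the poles of `f`, and at every
other point it is computed from the value of `f` there, after removing a removable singularity
(for a Mathlib-meromorphic function the pointwise value there may be arbitrary). -/
def logPlusAbs (f : ℂ → ℂ) (z : ℂ) : ℝ≥0∞ :=
  if meromorphicOrderAt f z < 0 then ∞
  else ENNReal.ofReal (Real.posLog ‖toMeromorphicNFAt f z z‖)

end Nevanlinna

end

/-!
Let `|z| ≤ r < R` and `K = (R + r) / (R - r)`. By the Poisson–Jensen formula `log⁺ |f z|` is at most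
`K * m(R, f)` plus the sum of the Green functions of the disc of radius `R` with poles at the poles
of `f`. The Green function with pole `u` is at most
`5 * K * log (R / max r |u|) * (1 + log⁺ (r / |z - u|))`, in which `log (R / max r |u|)` is exactly
the contribution of `u` to `N(R, f) - N(r, f)`. Integrating against `μ`, Fubini bounds the integral
of `log⁺ (r / |z - u|)` by `N_u^μ(r)`, uniformly in `u`.

A uniform bound on `N_z^μ(r₀)` for `z` in a disc larger than the one carrying `μ` forces `μ` to be
finite and without atoms. It passes to all centres, since the small closed discs centred outside the
larger disc are `μ`-null, and to all radii, since the mass of `μ` is finite. Conversely, the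
constant function `e` already recovers the finiteness of the supremum.
-/

noncomputable section

namespace Nevanlinna

open Complex InnerProductSpace MeromorphicOn Real Filter Function Topology ComplexConjugate

/-- The Green function of the disc of radius `R` about `0` with pole `u`, as a function of `w`. At
`w = u` it has the junk value `0` instead of `∞`. -/
def greenFunction (R : ℝ) (u w : ℂ) : ℝ :=
  Real.log ‖canonicalFactor R u w‖

lemma continuousOn_poissonKernel_sphere {R : ℝ} {c w : ℂ} (hw : w ∈ ball c R) :
    ContinuousOn (poissonKernel c w) (sphere c |R|) := by
  rw [poissonKernel_eq_re_herglotzRieszKernel]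
  exact continuous_re.comp_continuousOn (continuousOn_herglotzRieszKernel_sphere hw)

lemma circleIntegrable_poissonKernel_smul {R : ℝ} {c w : ℂ} {g : ℂ → ℝ} (hw : w ∈ ball c R)
    (hg : CircleIntegrable g c R) : CircleIntegrable (poissonKernel c w • g) c R :=
  hg.continuousOn_smul (continuousOn_poissonKernel_sphere hw)

lemma poissonKernel_nonneg {R : ℝ} {c w z : ℂ} (hw : w ∈ ball c R) (hz : z ∈ sphere c R) :
    0 ≤ poissonKernel c w z := by
  rw [mem_ball, dist_eq_norm] at hw
  rw [mem_sphere, dist_eq_norm] at hz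
  rw [poissonKernel_def, hz]
  exact div_nonneg (by nlinarith [norm_nonneg (w - c)]) (by positivity)

lemma poissonKernel_le {r R : ℝ} {c w z : ℂ} (hrR : r < R) (hw : w ∈ closedBall c r)
    (hz : z ∈ sphere c R) : poissonKernel c w z ≤ (R + r) / (R - r) := by
  have hwr : ‖w - c‖ ≤ r := by rwa [← dist_eq_norm]
  rw [poissonKernel_eq_re_herglotzRieszKernel]
  refine (re_herglotzRieszKernel_le hz (closedBall_subset_ball hrR hw)).trans ?_
  apply div_le_div₀ <;> linarith [norm_nonneg (w - c)]

lemma circleAverage_poissonKernel_smul_le {r R : ℝ} {c w : ℂ} {g₁ g₂ : ℂ → ℝ} (hrR : r < R)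
    (hw : w ∈ closedBall c r) (hg₁ : CircleIntegrable g₁ c R) (hg₂ : CircleIntegrable g₂ c R)
    (hnonneg : ∀ z ∈ sphere c R, 0 ≤ g₂ z) (hle : ∀ z ∈ sphere c R, g₁ z ≤ g₂ z) :
    circleAverage (poissonKernel c w • g₁) c R ≤ (R + r) / (R - r) * circleAverage g₂ c R := by
  have hwR : w ∈ ball c R := closedBall_subset_ball hrR hw
  rw [← smul_eq_mul, ← circleAverage_smul]
  refine circleAverage_mono (circleIntegrable_poissonKernel_smul hwR hg₁) hg₂.const_smul
    fun z hz ↦ ?_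
  rw [abs_of_pos (pos_of_mem_ball hwR)] at hz
  calc poissonKernel c w z * g₁ z ≤ poissonKernel c w z * g₂ z :=
        mul_le_mul_of_nonneg_left (hle z hz) (poissonKernel_nonneg hwR hz)
    _ ≤ (R + r) / (R - r) * g₂ z :=
        mul_le_mul_of_nonneg_right (poissonKernel_le hrR hw hz) (hnonneg z hz)

lemma circleAverage_poissonKernel_smul_log_norm_factorizedRational {R : ℝ} {c w : ℂ}
    (hw : w ∈ ball c R) (D : locallyFinsuppWithin (sphere c R) ℤ) :
    circleAverage (poissonKernel c w • ∑ᶠ v, ((D v : ℝ) * Real.log ‖· - v‖)) c R =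
      ∑ᶠ v, (D v : ℝ) * Real.log ‖w - v‖ := by
  have hsupport := D.finiteSupport (isCompact_sphere c R)
  have hterm {v : ℂ} : CircleIntegrable (fun z ↦ (D v : ℝ) * Real.log ‖z - v‖) c R :=
    (circleIntegrable_log_norm (f := (· - v)) fun z _ ↦ by fun_prop).const_smul
  rw [finsum_eq_sum_of_support_subset (s := hsupport.toFinset) _
      (fun v hv ↦ hsupport.mem_toFinset.2 fun h ↦ hv (by simp [h]; rfl)),
    finsum_eq_sum_of_support_subset (s := hsupport.toFinset) _
      (fun v hv ↦ hsupport.mem_toFinset.2 fun h ↦ hv (by simp [h])),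
    Finset.smul_sum, circleAverage_sum fun v _ ↦ circleIntegrable_poissonKernel_smul hw hterm]
  refine Finset.sum_congr rfl fun v hv ↦ ?_
  have hvR : v ∈ sphere c R := D.supportWithinDomain (hsupport.mem_toFinset.1 hv)
  rw [← circleAverage_re_herglotzRieszKernel_mul_log hvR hw,
    ← poissonKernel_eq_re_herglotzRieszKernel, ← smul_eq_mul, ← circleAverage_smul]
  congr 1
  ext z
  simp [mul_left_comm]

lemma log_norm_codiscreteWithin_eq_of_ecanonicalDecomp {R : ℝ} {f h : ℂ → ℂ}
    (D : ECanonicalDecomp f h R) :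
    (fun z ↦ Real.log ‖f z‖) =ᶠ[codiscreteWithin (sphere 0 R)]
      ∑ᶠ v, (divisor f (sphere 0 R) v * Real.log ‖· - v‖) + (Real.log ‖h ·‖) := by
  set P : ℂ → ℂ := ∏ᶠ v, (· - v) ^ divisor f (sphere 0 R) v
  have hP := extract_zeros_poles_log (f := P • h) (U := sphere (0 : ℂ) R)
    (D := divisor f (sphere 0 R)) (fun u ↦ D.ne_zero u (sphere_subset_closedBall u.2)) .rfl
  filter_upwards [hP, codiscreteWithin_mono sphere_subset_closedBall D.eventuallyEq,
    self_mem_codiscreteWithin _] with z hPz hDz hz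
  have hB : ‖(∏ᶠ u, canonicalFactor R u ^ (-divisor f (ball 0 R) u)) z‖ = 1 := by
    refine finprod_induction (p := fun g : ℂ → ℂ ↦ ‖g z‖ = 1) (by simp)
      (fun g₁ g₂ h₁ h₂ ↦ by simp [h₁, h₂]) fun u ↦ ?_
    by_cases hu : u ∈ ball 0 R
    · simp [norm_canonicalFactor_eval_circle_eq_one hu hz]
    · simp [(divisor f (ball 0 R)).apply_eq_zero_of_notMem hu]
  rw [← hPz, hDz, Pi.smul_apply', Pi.mul_apply, smul_eq_mul, norm_mul, norm_mul, hB, one_mul,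
    ← norm_mul]
  rfl

theorem circleAverage_poissonKernel_smul_log_norm {R : ℝ} {f : ℂ → ℂ} {w : ℂ}
    (hf : MeromorphicOn f (closedBall 0 R)) (hw : w ∈ ball 0 R)
    (hfw : meromorphicOrderAt f w = 0) :
    circleAverage (poissonKernel 0 w • (Real.log ‖f ·‖)) 0 R =
      Real.log ‖meromorphicTrailingCoeffAt f w‖ +
        ∑ᶠ u, divisor f (ball 0 R) u * greenFunction R u w := by
  have hR : 0 < R := pos_of_mem_ball hw
  have hwR : w ∈ closedBall 0 R := ball_subset_closedBall hw
  obtain ⟨h, D⟩ := hf.exists_ecanonicalDecomp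
    ((hf.exists_meromorphicOrderAt_ne_top_iff_forall (isConnected_closedBall hR.le)).1
      ⟨⟨w, hwR⟩, by simp [hfw]⟩)
  have hh : CircleIntegrable (Real.log ‖h ·‖) 0 R := circleIntegrable_log_norm fun z hz ↦
    (D.analyticOnNhd z (sphere_subset_closedBall (by rwa [abs_of_pos hR] at hz))).meromorphicAt
  have hharmonic : HarmonicOnNhd (Real.log ‖h ·‖) (closedBall 0 R) := fun z hz ↦
    (D.analyticOnNhd z hz).harmonicAt_log_norm (D.ne_zero z hz)
  have hlog : poissonKernel 0 w • (Real.log ‖f ·‖) =ᶠ[codiscreteWithin (sphere 0 |R|)]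
      poissonKernel 0 w • (∑ᶠ v, (divisor f (sphere 0 R) v * Real.log ‖· - v‖)) +
        poissonKernel 0 w • (Real.log ‖h ·‖) := by
    rw [← smul_add, abs_of_pos hR]
    exact (EventuallyEq.refl _ (poissonKernel 0 w)).smul
      (log_norm_codiscreteWithin_eq_of_ecanonicalDecomp D)
  rw [circleAverage_congr_codiscreteWithin hlog hR.ne', circleAverage_add
      (circleIntegrable_poissonKernel_smul hw (circleIntegrable_log_norm_factorizedRational _))
      (circleIntegrable_poissonKernel_smul hw hh),
    circleAverage_poissonKernel_smul_log_norm_factorizedRational hw,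
    hharmonic.circleAverage_poissonKernel_smul hw, D.log_norm_eq hwR hfw hR]
  simp only [greenFunction]
  ring

section GreenFunction

variable {r R : ℝ} {u w : ℂ}

lemma norm_sq_sub_conj_mul_sq (R : ℝ) (u w : ℂ) :
    ‖(R : ℂ) ^ 2 - conj u * w‖ ^ 2 =
      (R * ‖w - u‖) ^ 2 + (R ^ 2 - ‖u‖ ^ 2) * (R ^ 2 - ‖w‖ ^ 2) := by
  simp only [mul_pow, ← normSq_eq_norm_sq, normSq_apply, sub_re, sub_im, mul_re, mul_im, conj_re,
    conj_im, ← ofReal_pow, ofReal_re, ofReal_im]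
  ring

lemma norm_canonicalFactor (hR : 0 ≤ R) (u w : ℂ) :
    ‖canonicalFactor R u w‖ = ‖(R : ℂ) ^ 2 - conj u * w‖ / (R * ‖w - u‖) := by
  rw [canonicalFactor_apply, norm_div, norm_mul, norm_real, norm_of_nonneg hR]

lemma norm_canonicalFactor_sq (hR : 0 < R) (hwu : w ≠ u) :
    ‖canonicalFactor R u w‖ ^ 2 =
      1 + (R ^ 2 - ‖u‖ ^ 2) * (R ^ 2 - ‖w‖ ^ 2) / (R * ‖w - u‖) ^ 2 := by
  have hdist : ‖w - u‖ ≠ 0 := norm_sub_eq_zero_iff.not.2 hwu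
  rw [norm_canonicalFactor hR.le, div_pow, norm_sq_sub_conj_mul_sq, add_div,
    div_self (by positivity)]

lemma one_le_norm_canonicalFactor (hR : 0 < R) (hu : ‖u‖ ≤ R) (hw : ‖w‖ ≤ R) (hwu : w ≠ u) :
    1 ≤ ‖canonicalFactor R u w‖ := by
  rw [← one_le_sq_iff₀ (norm_nonneg _), norm_canonicalFactor_sq hR hwu, le_add_iff_nonneg_right]
  have hu₂ : ‖u‖ ^ 2 ≤ R ^ 2 := by gcongr
  have hw₂ : ‖w‖ ^ 2 ≤ R ^ 2 := by gcongr
  exact div_nonneg (mul_nonneg (sub_nonneg.2 hu₂) (sub_nonneg.2 hw₂)) (sq_nonneg _)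

lemma greenFunction_nonneg (hR : 0 < R) (hu : ‖u‖ ≤ R) (hw : ‖w‖ ≤ R) :
    0 ≤ greenFunction R u w := by
  rcases eq_or_ne w u with rfl | hwu
  · simp [greenFunction]
  · exact Real.log_nonneg (one_le_norm_canonicalFactor hR hu hw hwu)

lemma norm_canonicalFactor_le (hR : 0 < R) (hu : ‖u‖ ≤ R) (hw : ‖w‖ ≤ R) :
    ‖canonicalFactor R u w‖ ≤ 2 * R / ‖w - u‖ := by
  have hnum : ‖(R : ℂ) ^ 2 - conj u * w‖ ≤ R * (2 * R) := by
    calc ‖(R : ℂ) ^ 2 - conj u * w‖ ≤ ‖(R : ℂ) ^ 2‖ + ‖conj u * w‖ := norm_sub_le _ _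
      _ = R ^ 2 + ‖u‖ * ‖w‖ := by simp
      _ ≤ R ^ 2 + R * R := by gcongr
      _ = R * (2 * R) := by ring
  calc ‖canonicalFactor R u w‖ = ‖(R : ℂ) ^ 2 - conj u * w‖ / (R * ‖w - u‖) :=
        norm_canonicalFactor hR.le u w
    _ ≤ R * (2 * R) / (R * ‖w - u‖) := by gcongr
    _ = 2 * R / ‖w - u‖ := mul_div_mul_left _ _ hR.ne'

lemma greenFunction_le_div (hR : 0 < R) (hu : ‖u‖ ≤ R) (hw : ‖w‖ ≤ R) (hwu : w ≠ u) :
    greenFunction R u w ≤ (R ^ 2 - ‖u‖ ^ 2) * (R ^ 2 - ‖w‖ ^ 2) / (2 * (R * ‖w - u‖) ^ 2) := by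
  have hpos : 0 < ‖canonicalFactor R u w‖ :=
    zero_lt_one.trans_le (one_le_norm_canonicalFactor hR hu hw hwu)
  have hlog := Real.log_le_sub_one_of_pos (pow_pos hpos 2)
  rw [Real.log_pow, norm_canonicalFactor_sq hR hwu, add_sub_cancel_left, Nat.cast_ofNat] at hlog
  rw [mul_comm 2, ← div_div, le_div_iff₀' two_pos]
  exact hlog

lemma one_sub_div_le_log_div {a b : ℝ} (ha : 0 < a) (hb : 0 < b) :
    1 - a / b ≤ Real.log (b / a) := by
  simpa using Real.one_sub_inv_le_log_of_pos (div_pos hb ha)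

lemma greenFunction_le_of_far (hrR : r < R) (hw : ‖w‖ ≤ r) (hu : ‖u‖ ≤ R)
    (hfar : (R + r) / 2 ≤ ‖u‖) :
    greenFunction R u w ≤ 4 * ((R + r) / (R - r)) * Real.log (R / ‖u‖) := by
  have hw₀ : 0 ≤ ‖w‖ := norm_nonneg w
  have hR : 0 < R := by linarith
  have hu₀ : 0 < ‖u‖ := by linarith
  have hd : (R - ‖w‖) / 2 ≤ ‖w - u‖ := by
    rw [norm_sub_rev]
    linarith [norm_sub_norm_le u w]
  have hwu : w ≠ u := by
    rintro rfl
    linarith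
  have hnum : 0 ≤ (R ^ 2 - ‖u‖ ^ 2) * (R ^ 2 - ‖w‖ ^ 2) :=
    mul_nonneg (by nlinarith) (by nlinarith)
  have hRw : 0 < R - ‖w‖ := by linarith
  have : 0 < R - r := by linarith
  have hsum : 0 < R + r := by linarith [hw₀.trans hw]
  have hRu : 0 ≤ 1 - ‖u‖ / R := sub_nonneg.2 ((div_le_one hR).2 hu)
  calc greenFunction R u w
      ≤ (R ^ 2 - ‖u‖ ^ 2) * (R ^ 2 - ‖w‖ ^ 2) / (2 * (R * ‖w - u‖) ^ 2) :=
        greenFunction_le_div hR hu (by linarith) hwu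
    _ ≤ (R ^ 2 - ‖u‖ ^ 2) * (R ^ 2 - ‖w‖ ^ 2) / (2 * (R * ((R - ‖w‖) / 2)) ^ 2) := by gcongr
    _ = 2 * ((R + ‖w‖) / (R - ‖w‖)) * (1 + ‖u‖ / R) * (1 - ‖u‖ / R) := by
        field_simp
        ring
    _ ≤ 2 * ((R + r) / (R - r)) * (1 + R / R) * (1 - ‖u‖ / R) := by gcongr
    _ = 4 * ((R + r) / (R - r)) * (1 - ‖u‖ / R) := by
        rw [div_self hR.ne']
        ring
    _ ≤ 4 * ((R + r) / (R - r)) * Real.log (R / ‖u‖) := by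
        gcongr
        exact one_sub_div_le_log_div hu₀ hR

lemma greenFunction_le_log_add_posLog (hr : 0 < r) (hrR : r ≤ R) (hw : ‖w‖ ≤ r) (hu : ‖u‖ ≤ R)
    (hwu : w ≠ u) :
    greenFunction R u w ≤
      Real.log (R / max r ‖u‖) + Real.log 4 + Real.posLog (r / ‖w - u‖) := by
  have hR : 0 < R := hr.trans_le hrR
  have hwR : ‖w‖ ≤ R := hw.trans hrR
  have hd : 0 < ‖w - u‖ := norm_sub_pos_iff.2 hwu
  have hM : 0 < max r ‖u‖ := lt_max_of_lt_left hr
  have hM_le : max r ‖u‖ ≤ 2 * (‖w - u‖ * max 1 (r / ‖w - u‖)) := by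
    rw [mul_max_of_nonneg _ _ hd.le, mul_one, mul_div_cancel₀ _ hd.ne']
    have htri := norm_sub_norm_le u w
    rw [norm_sub_rev] at htri
    rcases max_cases r ‖u‖ with h | h <;> rcases max_cases ‖w - u‖ r with h' | h' <;> linarith
  rw [posLog_eq_log_max_one (by positivity), ← Real.log_mul (by positivity) (by norm_num),
    ← Real.log_mul (by positivity) (by positivity)]
  refine Real.log_le_log
    (zero_lt_one.trans_le (one_le_norm_canonicalFactor hR hu hwR hwu)) ?_
  refine (norm_canonicalFactor_le hR hu hwR).trans ?_
  rw [div_mul_eq_mul_div, div_mul_eq_mul_div, div_le_div_iff₀ hd hM]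
  nlinarith

lemma greenFunction_le_of_near (hr : 0 < r) (hrR : r < R) (hw : ‖w‖ ≤ r)
    (hnear : ‖u‖ ≤ (R + r) / 2) (hwu : w ≠ u) :
    greenFunction R u w ≤ 5 * ((R + r) / (R - r)) * Real.log (R / max r ‖u‖) *
      (1 + Real.posLog (r / ‖w - u‖)) := by
  have hR : 0 < R := hr.trans hrR
  set M := max r ‖u‖
  set K := (R + r) / (R - r)
  have hM : 0 < M := lt_max_of_lt_left hr
  have hMR : M ≤ (R + r) / 2 := max_le (by linarith) hnear
  have hlog : 0 ≤ Real.log (R / M) := Real.log_nonneg ((one_le_div hM).2 (by linarith))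
  have hK : 1 ≤ K := (one_le_div (by linarith)).2 (by linarith)
  -- This lower bound lets the additive constant `log 4` be absorbed into the factor `5`.
  have hK_log : 1 / 2 ≤ K * Real.log (R / M) :=
    calc 1 / 2 ≤ K * (1 - (R + r) / 2 / R) := by
          rw [one_sub_div hR.ne', div_mul_div_comm, div_le_div_iff₀ two_pos (by nlinarith)]
          nlinarith
      _ ≤ K * (1 - M / R) := by gcongr
      _ ≤ K * Real.log (R / M) := by
          gcongr
          exact one_sub_div_le_log_div hM hR
  have hlog_four : Real.log 4 ≤ 2 := by
    rw [show (4 : ℝ) = 2 ^ 2 by norm_num, Real.log_pow, Nat.cast_ofNat]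
    linarith [Real.log_two_lt_d9]
  have hposLog : 0 ≤ Real.posLog (r / ‖w - u‖) := posLog_nonneg
  have hgreen := greenFunction_le_log_add_posLog hr hrR.le hw (by linarith) hwu
  nlinarith [le_mul_of_one_le_left hlog hK]

theorem greenFunction_le (hr : 0 < r) (hrR : r < R) (hw : ‖w‖ ≤ r) (hu : ‖u‖ ≤ R) (hwu : w ≠ u) :
    greenFunction R u w ≤ 5 * ((R + r) / (R - r)) * Real.log (R / max r ‖u‖) *
      (1 + Real.posLog (r / ‖w - u‖)) := by
  rcases le_total ‖u‖ ((R + r) / 2) with hnear | hfar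
  · exact greenFunction_le_of_near hr hrR hw hnear hwu
  · have : 0 < R - r := sub_pos.2 hrR
    have hsum : 0 < R + r := by linarith
    have hlog : 0 ≤ Real.log (R / ‖u‖) := Real.log_nonneg ((one_le_div (by linarith)).2 hu)
    rw [max_eq_right (by linarith)]
    calc greenFunction R u w ≤ 4 * ((R + r) / (R - r)) * Real.log (R / ‖u‖) * 1 := by
          rw [mul_one]
          exact greenFunction_le_of_far hrR hw hu hfar
      _ ≤ 5 * ((R + r) / (R - r)) * Real.log (R / ‖u‖) * (1 + Real.posLog (r / ‖w - u‖)) := by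
          gcongr
          · norm_num
          · exact le_add_of_nonneg_right posLog_nonneg

end GreenFunction

section Poles

variable {t R : ℝ} {f : ℂ → ℂ} {u : ℂ}

/-- The poles of `f` in the closed disc of radius `R` about `0`, as a finite set; it is empty if `f`
is not meromorphic there. -/
def poles (f : ℂ → ℂ) (R : ℝ) : Finset ℂ :=
  ((divisor f (closedBall 0 R))⁻.finiteSupport (isCompact_closedBall 0 R)).toFinset

lemma mem_poles (hf : MeromorphicOn f (closedBall 0 R)) :
    u ∈ poles f R ↔ u ∈ closedBall 0 R ∧ meromorphicOrderAt f u < 0 := by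
  rw [poles, Set.Finite.mem_toFinset, mem_support, locallyFinsuppWithin.negPart_apply]
  by_cases hu : u ∈ closedBall 0 R
  · rw [divisor_apply hf hu]
    cases h : meromorphicOrderAt f u <;> simp [hu]
  · simp [hu]

lemma poleMultiplicity_eq_zero (h : 0 ≤ meromorphicOrderAt f u) : poleMultiplicity f u = 0 := by
  rw [poleMultiplicity, Int.toNat_eq_zero, neg_nonpos]
  exact WithTop.untop₀_nonneg.2 h

lemma poleCount_eq_sum (hf : MeromorphicOn f (closedBall 0 R)) (ht : t ≤ R) :
    poleCount t f = ∑ u ∈ poles f R, if ‖u‖ ≤ t then poleMultiplicity f u else 0 := by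
  rw [poleCount, ← Finset.sum_filter]
  refine finsum_mem_eq_sum_of_inter_support_eq _ (Set.ext fun u ↦ ?_)
  simp only [Set.mem_inter_iff, mem_closedBall_zero_iff, mem_support, Finset.coe_filter,
    Set.mem_ofPred_eq, mem_poles hf]
  refine ⟨fun ⟨hut, hmult⟩ ↦ ⟨⟨⟨hut.trans ht, ?_⟩, hut⟩, hmult⟩,
    fun ⟨⟨_, hut⟩, hmult⟩ ↦ ⟨hut, hmult⟩⟩
  exact lt_of_not_ge fun h ↦ hmult (poleMultiplicity_eq_zero h)

lemma intervalIntegrable_indicator_Ici_inv {a : ℝ} (ha : 0 < a) (b c : ℝ) :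
    IntervalIntegrable ((Set.Ici a).indicator fun t ↦ t⁻¹) volume b c := by
  refine (intervalIntegrable_const (c := a⁻¹)).mono_fun
    (measurable_inv.indicator measurableSet_Ici).aestronglyMeasurable (ae_of_all _ fun t ↦ ?_)
  beta_reduce
  rw [norm_of_nonneg (inv_nonneg.2 ha.le)]
  by_cases hat : a ≤ t
  · rw [Set.indicator_of_mem (Set.mem_Ici.2 hat), norm_of_nonneg (inv_nonneg.2 (ha.le.trans hat))]
    exact inv_anti₀ ha hat
  · rw [Set.indicator_of_notMem (mt Set.mem_Ici.1 hat), norm_zero]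
    exact inv_nonneg.2 ha.le

lemma integral_indicator_Ici_inv {a b : ℝ} (ha : 0 < a) (hb : 0 ≤ b) :
    ∫ t in 0..b, (Set.Ici a).indicator (fun t ↦ t⁻¹) t = Real.log (max b a) - Real.log a := by
  have hset : Set.Ioc 0 b ∩ Set.Ici a = Set.Icc a b :=
    Set.ext fun t ↦ ⟨fun h ↦ ⟨h.2, h.1.2⟩, fun h ↦ ⟨⟨ha.trans_le h.1, h.2⟩, h.1⟩⟩
  rw [intervalIntegral.integral_of_le hb, setIntegral_indicator measurableSet_Ici, hset,
    integral_Icc_eq_integral_Ioc]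
  rcases le_total a b with hab | hba
  · rw [← intervalIntegral.integral_of_le hab, integral_inv_of_pos ha (ha.trans_le hab),
      max_eq_left hab, Real.log_div (ha.trans_le hab).ne' ha.ne']
  · rw [Set.Ioc_eq_empty hba.not_gt, setIntegral_empty, max_eq_right hba, sub_self]

lemma poleCount_sub_poleCount_zero_div (hf : MeromorphicOn f (closedBall 0 R)) (ht : 0 < t)
    (htR : t ≤ R) :
    ((poleCount t f : ℝ) - poleCount 0 f) / t =
      ∑ u ∈ poles f R with u ≠ 0,
        poleMultiplicity f u * (Set.Ici ‖u‖).indicator (fun t ↦ t⁻¹) t := by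
  rw [poleCount_eq_sum hf htR, poleCount_eq_sum hf (ht.le.trans htR), Nat.cast_sum, Nat.cast_sum,
    ← Finset.sum_sub_distrib, Finset.sum_div, Finset.sum_filter]
  refine Finset.sum_congr rfl fun u _ ↦ ?_
  by_cases hu : u = 0
  · simp [hu, ht.le]
  · by_cases hut : ‖u‖ ≤ t <;> simp [hu, hut, div_eq_mul_inv]

-- A pole at the origin contributes `log ρ`, because `Real.log 0 = 0`.
lemma poleCounting_eq_sum {ρ : ℝ} (hf : MeromorphicOn f (closedBall 0 R)) (hρ : 0 < ρ)
    (hρR : ρ ≤ R) :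
    poleCounting ρ f =
      ∑ u ∈ poles f R, poleMultiplicity f u * (Real.log (max ρ ‖u‖) - Real.log ‖u‖) := by
  have hint : ∫ t in 0..ρ, ((poleCount t f : ℝ) - poleCount 0 f) / t =
      ∑ u ∈ poles f R with u ≠ 0,
        poleMultiplicity f u * (Real.log (max ρ ‖u‖) - Real.log ‖u‖) := by
    rw [intervalIntegral.integral_congr_ae (ae_of_all _ fun t ht ↦ ?_),
      intervalIntegral.integral_finsetSum fun u hu ↦ ?_]
    · refine Finset.sum_congr rfl fun u hu ↦ ?_
      rw [intervalIntegral.integral_const_mul,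
        integral_indicator_Ici_inv (norm_pos_iff.2 (Finset.mem_filter.1 hu).2) hρ.le]
    · exact (intervalIntegrable_indicator_Ici_inv
        (norm_pos_iff.2 (Finset.mem_filter.1 hu).2) 0 ρ).const_mul _
    · rw [Set.uIoc_of_le hρ.le] at ht
      exact poleCount_sub_poleCount_zero_div hf ht.1 (ht.2.trans hρR)
  have hzero : poleCount 0 f * Real.log ρ = ∑ u ∈ poles f R with ¬u ≠ 0,
      poleMultiplicity f u * (Real.log (max ρ ‖u‖) - Real.log ‖u‖) := by
    simp only [poleCount_eq_sum hf (hρ.le.trans hρR), norm_le_zero_iff, Nat.cast_sum, not_not,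
      Finset.sum_mul, Finset.sum_filter]
    refine Finset.sum_congr rfl fun u _ ↦ ?_
    split_ifs with hu <;> simp [hu, hρ.le]
  rw [poleCounting, hint, hzero, Finset.sum_filter_add_sum_filter_not]

/-- The contribution of a pole `u` of `f` to the difference `N(R, f) - N(r, f)`. -/
def poleWeight (f : ℂ → ℂ) (r R : ℝ) (u : ℂ) : ℝ :=
  poleMultiplicity f u * Real.log (R / max r ‖u‖)

lemma poleWeight_nonneg {r : ℝ} (hr : 0 < r) (hrR : r ≤ R) (hu : ‖u‖ ≤ R) :
    0 ≤ poleWeight f r R u :=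
  mul_nonneg (Nat.cast_nonneg _)
    (Real.log_nonneg ((one_le_div (lt_max_of_lt_left hr)).2 (max_le hrR hu)))

lemma poleCounting_sub_poleCounting {r : ℝ} (hr : 0 < r) (hrR : r ≤ R)
    (hf : MeromorphicOn f (closedBall 0 R)) :
    poleCounting R f - poleCounting r f = ∑ u ∈ poles f R, poleWeight f r R u := by
  have hR : 0 < R := hr.trans_le hrR
  rw [poleCounting_eq_sum hf hR le_rfl, poleCounting_eq_sum hf hr hrR, ← Finset.sum_sub_distrib]
  refine Finset.sum_congr rfl fun u hu ↦ ?_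
  have huR : ‖u‖ ≤ R := mem_closedBall_zero_iff.1 ((mem_poles hf).1 hu).1
  rw [poleWeight, Real.log_div hR.ne' (lt_max_of_lt_left hr).ne', max_eq_left huR]
  ring

lemma nevanlinnaT_sub_poleCounting {r : ℝ} (hr : 0 < r) (hrR : r ≤ R)
    (hf : MeromorphicOn f (closedBall 0 R)) :
    nevanlinnaT R f - poleCounting r f =
      circleAverage (Real.posLog ‖f ·‖) 0 R + ∑ u ∈ poles f R, poleWeight f r R u := by
  rw [nevanlinnaT, add_sub_assoc, poleCounting_sub_poleCounting hr hrR hf]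

end Poles

section PointwiseBound

variable {r R : ℝ} {f : ℂ → ℂ} {w : ℂ}

lemma meromorphicTrailingCoeffAt_eq_toMeromorphicNFAt (hf : MeromorphicAt f w)
    (hfw : meromorphicOrderAt f w = 0) :
    meromorphicTrailingCoeffAt f w = toMeromorphicNFAt f w w := by
  rw [meromorphicTrailingCoeffAt_congr_nhdsNE hf.eq_nhdsNE_toMeromorphicNFAt]
  exact AnalyticAt.meromorphicTrailingCoeffAt_of_ne_zero
    (hf.meromorphicOrderAt_nonneg_iff_analyticAt_toMeromorphicNFAt.1 hfw.ge)
    (hf.meromorphicOrderAt_eq_zero_iff_toMeromorphicNFAt_ne_zero.1 hfw)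

lemma neg_divisor_le_poleMultiplicity (f : ℂ → ℂ) (U : Set ℂ) (u : ℂ) :
    -divisor f U u ≤ poleMultiplicity f u := by
  rw [divisor_def]
  split_ifs
  · exact Int.self_le_toNat _
  · exact neg_zero.trans_le (Int.natCast_nonneg _)

lemma finite_support_divisor_ball (hf : MeromorphicOn f (closedBall 0 R)) :
    (support (divisor f (ball 0 R))).Finite := by
  refine ((divisor f (closedBall 0 R)).finiteSupport (isCompact_closedBall 0 R)).subset
    fun u hu ↦ ?_
  have huR : u ∈ ball 0 R := (divisor f (ball 0 R)).supportWithinDomain hu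
  rwa [mem_support, divisor_apply hf (ball_subset_closedBall huR),
    ← divisor_apply (hf.mono_set ball_subset_closedBall) huR]

lemma neg_finsum_divisor_mul_greenFunction_le (hf : MeromorphicOn f (closedBall 0 R))
    (hw : w ∈ ball 0 R) :
    -∑ᶠ u, divisor f (ball 0 R) u * greenFunction R u w ≤
      ∑ u ∈ poles f R, poleMultiplicity f u * greenFunction R u w := by
  have hfinite := finite_support_divisor_ball hf
  set S := hfinite.toFinset ∪ poles f R
  have hS : ∀ u ∈ S, u ∈ closedBall 0 R := fun u hu ↦ by
    rcases Finset.mem_union.1 hu with h | h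
    · exact ball_subset_closedBall
        ((divisor f (ball 0 R)).supportWithinDomain (hfinite.mem_toFinset.1 h))
    · exact ((mem_poles hf).1 h).1
  have hsupport : support (fun u ↦ divisor f (ball 0 R) u * greenFunction R u w) ⊆ S :=
    fun u hu ↦ Finset.mem_union_left _ <| hfinite.mem_toFinset.2 fun h ↦ hu (by simp [h])
  rw [finsum_eq_sum_of_support_subset _ hsupport, ← Finset.sum_neg_distrib]
  calc ∑ u ∈ S, -(divisor f (ball 0 R) u * greenFunction R u w)
      ≤ ∑ u ∈ S, poleMultiplicity f u * greenFunction R u w := by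
        refine Finset.sum_le_sum fun u hu ↦ ?_
        rw [← neg_mul]
        refine mul_le_mul_of_nonneg_right ?_ (greenFunction_nonneg (pos_of_mem_ball hw)
          (mem_closedBall_zero_iff.1 (hS u hu)) (mem_ball_zero_iff.1 hw).le)
        exact_mod_cast neg_divisor_le_poleMultiplicity f (ball 0 R) u
    _ = ∑ u ∈ poles f R, poleMultiplicity f u * greenFunction R u w := by
        refine (Finset.sum_subset Finset.subset_union_right fun u huS hu ↦ ?_).symm
        rw [poleMultiplicity_eq_zero, Nat.cast_zero, zero_mul]
        exact not_lt.1 fun h ↦ hu ((mem_poles hf).2 ⟨hS u huS, h⟩)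

theorem posLog_norm_toMeromorphicNFAt_le (hrR : r < R) (hf : MeromorphicOn f (closedBall 0 R))
    (hw : w ∈ closedBall 0 r) :
    Real.posLog ‖toMeromorphicNFAt f w w‖ ≤
      (R + r) / (R - r) * circleAverage (Real.posLog ‖f ·‖) 0 R +
        ∑ u ∈ poles f R, poleMultiplicity f u * greenFunction R u w := by
  have hwR : w ∈ ball 0 R := closedBall_subset_ball hrR hw
  have hR : 0 < R := pos_of_mem_ball hwR
  have hr : 0 ≤ r := nonempty_closedBall.1 ⟨w, hw⟩
  have hnonneg : 0 ≤ (R + r) / (R - r) * circleAverage (Real.posLog ‖f ·‖) 0 R +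
      ∑ u ∈ poles f R, poleMultiplicity f u * greenFunction R u w := by
    refine add_nonneg (mul_nonneg (div_nonneg (by linarith) (by linarith))
      (circleAverage_nonneg_of_nonneg fun _ _ ↦ posLog_nonneg))
      (Finset.sum_nonneg fun u hu ↦ mul_nonneg (Nat.cast_nonneg _) (greenFunction_nonneg hR ?_ ?_))
    · exact mem_closedBall_zero_iff.1 ((mem_poles hf).1 hu).1
    · exact (mem_ball_zero_iff.1 hwR).le
  have hfw := hf w (ball_subset_closedBall hwR)
  by_cases horder : meromorphicOrderAt f w = 0
  · have hsphere : MeromorphicOn f (sphere 0 |R|) :=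
      hf.mono_set (by rw [abs_of_pos hR]; exact sphere_subset_closedBall)
    have hPJ := circleAverage_poissonKernel_smul_log_norm hf hwR horder
    rw [meromorphicTrailingCoeffAt_eq_toMeromorphicNFAt hfw horder] at hPJ
    have haverage := circleAverage_poissonKernel_smul_le hrR hw hsphere.circleIntegrable_log_norm
      hsphere.circleIntegrable_posLog_norm (fun _ _ ↦ posLog_nonneg) (fun _ _ ↦ le_max_right _ _)
    exact max_le hnonneg (by linarith [neg_finsum_divisor_mul_greenFunction_le hf hwR])
  · have hzero : toMeromorphicNFAt f w w = 0 := not_not.1 <|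
      mt hfw.meromorphicOrderAt_eq_zero_iff_toMeromorphicNFAt_ne_zero.2 horder
    rwa [hzero, norm_zero, posLog_zero]

end PointwiseBound

section MeasureCounting

variable {μ : Measure ℂ} {z : ℂ} {s : ℝ}

lemma setLIntegral_Icc_inv {d : ℝ} (hd : 0 < d) (hs : 0 < s) :
    ∫⁻ t in Set.Icc d s, (ENNReal.ofReal t)⁻¹ = ENNReal.ofReal (Real.posLog (s / d)) := by
  rcases le_total d s with hds | hsd
  · have hinv : ∀ t ∈ Set.Icc d s, (ENNReal.ofReal t)⁻¹ = ENNReal.ofReal t⁻¹ :=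
      fun t ht ↦ (ENNReal.ofReal_inv_of_pos (hd.trans_le ht.1)).symm
    have hint : IntegrableOn (fun t : ℝ ↦ t⁻¹) (Set.Icc d s) :=
      (continuousOn_id.inv₀ fun t ht ↦ (hd.trans_le ht.1).ne').integrableOn_Icc
    rw [setLIntegral_congr_fun measurableSet_Icc hinv, ← ofReal_integral_eq_lintegral_ofReal hint
        (ae_restrict_of_forall_mem measurableSet_Icc fun t ht ↦ inv_nonneg.2 (hd.le.trans ht.1)),
      integral_Icc_eq_integral_Ioc, ← intervalIntegral.integral_of_le hds,
      integral_inv_of_pos hd hs, posLog_eq_log]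
    rwa [abs_of_pos (div_pos hs hd), one_le_div hd]
  · rw [← restrict_Ioc_eq_restrict_Icc, Set.Ioc_eq_empty hsd.not_gt, Measure.restrict_empty,
      lintegral_zero_measure, (posLog_eq_zero_iff _).2, ENNReal.ofReal_zero]
    rwa [abs_of_pos (div_pos hs hd), div_le_one hd]

lemma measure_mul_posLog_le_measureCounting (μ : Measure ℂ) (z : ℂ) {d : ℝ} (hd : 0 < d)
    (hs : 0 < s) :
    μ (closedBall z d) * ENNReal.ofReal (Real.posLog (s / d)) ≤ measureCounting μ z s := by
  rw [← setLIntegral_Icc_inv hd hs, ← lintegral_const_mul _ (by fun_prop)]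
  calc ∫⁻ t in Set.Icc d s, μ (closedBall z d) * (ENNReal.ofReal t)⁻¹
      ≤ ∫⁻ t in Set.Icc d s, μ (closedBall z t) / ENNReal.ofReal t := by
        refine setLIntegral_mono' measurableSet_Icc fun t ht ↦ ?_
        rw [div_eq_mul_inv]
        gcongr
        exact ht.1
    _ ≤ measureCounting μ z s := lintegral_mono_set (Set.Icc_subset_Ioc hd le_rfl)

lemma measure_closedBall_mul_le_measureCounting (μ : Measure ℂ) (z : ℂ) (hs : 0 < s) (n : ℕ) :
    μ (closedBall z (s * Real.exp (-n))) * n ≤ measureCounting μ z s := by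
  have h := measure_mul_posLog_le_measureCounting μ z (mul_pos hs (Real.exp_pos (-n))) hs
  rwa [div_mul_cancel_left₀ hs.ne', ← Real.exp_neg, neg_neg, posLog_apply, Real.log_exp,
    max_eq_right (Nat.cast_nonneg n), ENNReal.ofReal_natCast] at h

lemma measure_singleton_eq_zero_of_measureCounting_lt_top (hs : 0 < s)
    (h : measureCounting μ z s < ∞) : μ {z} = 0 := by
  by_contra hne
  obtain ⟨n, hn⟩ := ENNReal.exists_nat_mul_gt hne h.ne
  refine hn.not_ge ?_
  calc n * μ {z} ≤ n * μ (closedBall z (s * Real.exp (-n))) := by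
        gcongr
        exact Set.singleton_subset_iff.2 (mem_closedBall_self (by positivity))
    _ ≤ measureCounting μ z s := by
        rw [mul_comm]
        exact measure_closedBall_mul_le_measureCounting μ z hs n

lemma measureCounting_eq_lintegral (μ : Measure ℂ) [SFinite μ] (z : ℂ) (s : ℝ) :
    measureCounting μ z s =
      ∫⁻ w, ∫⁻ t in Set.Ioc 0 s, (Set.Ici (dist w z)).indicator (fun t ↦ (ENNReal.ofReal t)⁻¹) t
        ∂volume ∂μ := by
  have hmeas : Measurable (uncurry fun (w : ℂ) ↦
      (Set.Ici (dist w z)).indicator fun t ↦ (ENNReal.ofReal t)⁻¹) :=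
    Measurable.indicator (f := fun p : ℂ × ℝ ↦ (ENNReal.ofReal p.2)⁻¹)
      (s := {p : ℂ × ℝ | dist p.1 z ≤ p.2}) (by fun_prop)
      (measurableSet_le (by fun_prop) (by fun_prop))
  rw [lintegral_lintegral_swap hmeas.aemeasurable]
  refine lintegral_congr fun t ↦ ?_
  have hball : (fun w ↦ (Set.Ici (dist w z)).indicator (fun t ↦ (ENNReal.ofReal t)⁻¹) t) =
      (closedBall z t).indicator fun _ ↦ (ENNReal.ofReal t)⁻¹ := rfl
  rw [hball, lintegral_indicator_const measurableSet_closedBall, mul_comm, div_eq_mul_inv]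

lemma lintegral_posLog_le_measureCounting (μ : Measure ℂ) [SFinite μ] (z : ℂ) (hs : 0 < s) :
    ∫⁻ w, ENNReal.ofReal (Real.posLog (s / ‖w - z‖)) ∂μ ≤ measureCounting μ z s := by
  rw [measureCounting_eq_lintegral]
  refine lintegral_mono fun w ↦ ?_
  -- At `w = z` the left-hand side has the junk value `log⁺ (s / 0) = 0`.
  rcases eq_or_ne w z with rfl | hwz
  · simp
  have hd : 0 < dist w z := dist_pos.2 hwz
  rw [← dist_eq_norm, ← setLIntegral_Icc_inv hd hs, setLIntegral_indicator measurableSet_Ici]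
  exact lintegral_mono_set fun t ht ↦ ⟨ht.1, hd.trans_le ht.1, ht.2⟩

lemma setLIntegral_one_add_posLog_le (μ : Measure ℂ) [SFinite μ] (A : Set ℂ) (z : ℂ)
    (hs : 0 < s) :
    ∫⁻ w in A, (1 + ENNReal.ofReal (Real.posLog (s / ‖w - z‖))) ∂μ ≤
      μ A + measureCounting μ z s := by
  rw [lintegral_add_left measurable_const, lintegral_one, Measure.restrict_apply_univ]
  gcongr
  exact (setLIntegral_le_lintegral _ _).trans (lintegral_posLog_le_measureCounting μ z hs)

lemma measureCounting_mono (μ : Measure ℂ) (z : ℂ) : Monotone (measureCounting μ z) :=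
  fun _ _ h ↦ lintegral_mono_set (Set.Ioc_subset_Ioc_right h)

lemma measureCounting_eq_zero (h : μ (closedBall z s) = 0) : measureCounting μ z s = 0 := by
  rw [measureCounting, setLIntegral_congr_fun (g := fun _ ↦ 0) measurableSet_Ioc fun t ht ↦ ?_,
    lintegral_zero]
  rw [measure_mono_null (closedBall_subset_closedBall ht.2) h, ENNReal.zero_div]

lemma measureCounting_le_add (μ : Measure ℂ) (z : ℂ) (s ε : ℝ) :
    measureCounting μ z s ≤
      measureCounting μ z ε + μ Set.univ / ENNReal.ofReal ε * ENNReal.ofReal (s - ε) := by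
  calc measureCounting μ z s
      ≤ ∫⁻ t in Set.Ioc 0 ε ∪ Set.Ioc ε s, μ (closedBall z t) / ENNReal.ofReal t :=
        lintegral_mono_set Set.Ioc_subset_Ioc_union_Ioc
    _ ≤ measureCounting μ z ε + ∫⁻ t in Set.Ioc ε s, μ (closedBall z t) / ENNReal.ofReal t :=
        lintegral_union_le _ _ _
    _ ≤ measureCounting μ z ε + ∫⁻ _ in Set.Ioc ε s, μ Set.univ / ENNReal.ofReal ε := by
        gcongr _ + ?_
        refine setLIntegral_mono' measurableSet_Ioc fun t ht ↦ ?_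
        gcongr
        · exact Set.subset_univ _
        · exact ht.1.le
    _ = measureCounting μ z ε + μ Set.univ / ENNReal.ofReal ε * ENNReal.ofReal (s - ε) := by
        rw [setLIntegral_const, Real.volume_Ioc]

lemma isFiniteMeasure_of_measureCounting_lt_top {K : Set ℂ} (hK : IsCompact K) (hμ : μ Kᶜ = 0)
    (hs : 0 < s) (h : ∀ z ∈ K, measureCounting μ z s < ∞) : IsFiniteMeasure μ := by
  have hμK : μ K < ∞ := by
    refine hK.measure_lt_top_of_nhdsWithin fun z hz ↦ Measure.FiniteAtFilter.filter_mono
      nhdsWithin_le_nhds ⟨_, closedBall_mem_nhds z (mul_pos hs (Real.exp_pos (-(1 : ℕ)))), ?_⟩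
    have hle := measure_closedBall_mul_le_measureCounting μ z hs 1
    exact (le_mul_of_one_le_right' (Nat.one_le_cast.2 le_rfl)).trans_lt (hle.trans_lt (h z hz))
  refine ⟨?_⟩
  calc μ Set.univ ≤ μ K + μ Kᶜ := by
        rw [← Set.union_compl_self K]
        exact measure_union_le _ _
    _ < ∞ := by rwa [hμ, add_zero]

lemma iSup_measureCounting_lt_top [IsFiniteMeasure μ] {r r₀ R : ℝ} (hr₀ : 0 < r₀) (hrR : r < R)
    (hμ : μ (closedBall (0 : ℂ) r)ᶜ = 0)
    (h : (⨆ z ∈ closedBall (0 : ℂ) R, measureCounting μ z r₀) < ∞) (s : ℝ) :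
    (⨆ z, measureCounting μ z s) < ∞ := by
  set ε := min r₀ (R - r)
  have hε : 0 < ε := lt_min hr₀ (sub_pos.2 hrR)
  have hle : ∀ z, measureCounting μ z ε ≤ ⨆ z ∈ closedBall (0 : ℂ) R, measureCounting μ z r₀ := by
    intro z
    by_cases hz : z ∈ closedBall (0 : ℂ) R
    · exact (measureCounting_mono μ z (min_le_left _ _)).trans
        (le_biSup (fun z ↦ measureCounting μ z r₀) hz)
    · refine (measureCounting_eq_zero (measure_mono_null ?_ hμ)).trans_le zero_le
      refine (closedBall_disjoint_closedBall ?_).subset_compl_right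
      rw [mem_closedBall, not_le] at hz
      linarith [min_le_right r₀ (R - r)]
  calc (⨆ z, measureCounting μ z s)
      ≤ (⨆ z ∈ closedBall (0 : ℂ) R, measureCounting μ z r₀) +
          μ Set.univ / ENNReal.ofReal ε * ENNReal.ofReal (s - ε) :=
        iSup_le fun z ↦ (measureCounting_le_add μ z s ε).trans (by gcongr; exact hle z)
    _ < ∞ := ENNReal.add_lt_top.2 ⟨h, ENNReal.mul_lt_top
        (ENNReal.div_lt_top (measure_ne_top _ _) (ENNReal.ofReal_pos.2 hε).ne')
        ENNReal.ofReal_lt_top⟩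

end MeasureCounting

section LogPlusAbs

variable {r R : ℝ} {f : ℂ → ℂ} {z : ℂ}

lemma logPlusAbs_of_analyticAt (hf : AnalyticAt ℂ f z) :
    logPlusAbs f z = ENNReal.ofReal (Real.posLog ‖f z‖) := by
  rw [logPlusAbs, if_neg hf.meromorphicOrderAt_nonneg.not_gt,
    toMeromorphicNFAt_eq_self.2 hf.meromorphicNFAt]

lemma continuousAt_logPlusAbs (hf : MeromorphicAt f z) : ContinuousAt (logPlusAbs f) z := by
  have hpunctured : ∀ᶠ w in 𝓝[≠] z, ENNReal.ofReal (Real.posLog ‖f w‖) = logPlusAbs f w := by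
    filter_upwards [hf.eventually_analyticAt] with w hw using (logPlusAbs_of_analyticAt hw).symm
  rw [continuousAt_iff_punctured_nhds]
  refine Tendsto.congr' hpunctured ?_
  by_cases horder : meromorphicOrderAt f z < 0
  · rw [logPlusAbs, if_pos horder]
    refine ENNReal.tendsto_ofReal_atTop.comp ?_
    exact tendsto_atTop_mono (fun w ↦ le_max_right _ _) <| Real.tendsto_log_atTop.comp <|
      tendsto_norm_cobounded_atTop.comp (tendsto_cobounded_of_meromorphicOrderAt_neg horder)
  · rw [logPlusAbs, if_neg horder]
    have hanalytic := hf.meromorphicOrderAt_nonneg_iff_analyticAt_toMeromorphicNFAt.1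
      (not_lt.1 horder)
    have hlim := (continuousAt_iff_punctured_nhds.1 hanalytic.continuousAt).congr'
      hf.eq_nhdsNE_toMeromorphicNFAt.symm
    exact ENNReal.tendsto_ofReal ((continuous_posLog.tendsto _).comp hlim.norm)

lemma aemeasurable_logPlusAbs (hf : MeromorphicOn f (closedBall 0 r)) (μ : Measure ℂ) :
    AEMeasurable (logPlusAbs f) (μ.restrict (closedBall 0 r)) :=
  ContinuousOn.aemeasurable (fun z hz ↦ (continuousAt_logPlusAbs (hf z hz)).continuousWithinAt)
    measurableSet_closedBall

lemma posLog_norm_le_sum_poleWeight (hr : 0 < r) (hrR : r < R)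
    (hf : MeromorphicOn f (closedBall 0 R)) (hz : z ∈ closedBall 0 r) (hz' : z ∉ poles f R) :
    Real.posLog ‖toMeromorphicNFAt f z z‖ ≤
      5 * ((R + r) / (R - r)) * (circleAverage (Real.posLog ‖f ·‖) 0 R +
        ∑ u ∈ poles f R, poleWeight f r R u * (1 + Real.posLog (r / ‖z - u‖))) := by
  have hK : 0 ≤ (R + r) / (R - r) := div_nonneg (by linarith) (by linarith)
  have hm : 0 ≤ circleAverage (Real.posLog ‖f ·‖) 0 R :=
    circleAverage_nonneg_of_nonneg fun _ _ ↦ posLog_nonneg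
  refine (posLog_norm_toMeromorphicNFAt_le hrR hf hz).trans ?_
  rw [mul_add, Finset.mul_sum]
  refine add_le_add (mul_le_mul_of_nonneg_right (by linarith) hm)
    (Finset.sum_le_sum fun u hu ↦ ?_)
  have hgreen := greenFunction_le hr hrR (mem_closedBall_zero_iff.1 hz)
    (mem_closedBall_zero_iff.1 ((mem_poles hf).1 hu).1) (ne_of_mem_of_not_mem hu hz').symm
  calc poleMultiplicity f u * greenFunction R u z
      ≤ poleMultiplicity f u * (5 * ((R + r) / (R - r)) * Real.log (R / max r ‖u‖) *
          (1 + Real.posLog (r / ‖z - u‖))) := by gcongr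
    _ = 5 * ((R + r) / (R - r)) * (poleWeight f r R u * (1 + Real.posLog (r / ‖z - u‖))) := by
      rw [poleWeight]
      ring

lemma logPlusAbs_le_sum_poleWeight (hr : 0 < r) (hrR : r < R)
    (hf : MeromorphicOn f (closedBall 0 R)) (hz : z ∈ closedBall 0 r) (hz' : z ∉ poles f R) :
    logPlusAbs f z ≤ ENNReal.ofReal (5 * ((R + r) / (R - r))) *
      (ENNReal.ofReal (circleAverage (Real.posLog ‖f ·‖) 0 R) +
        ∑ u ∈ poles f R, ENNReal.ofReal (poleWeight f r R u) *
          (1 + ENNReal.ofReal (Real.posLog (r / ‖z - u‖)))) := by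
  have hK : 0 ≤ 5 * ((R + r) / (R - r)) :=
    mul_nonneg (by norm_num) (div_nonneg (by linarith) (by linarith))
  have hweight : ∀ u ∈ poles f R, 0 ≤ poleWeight f r R u := fun u hu ↦
    poleWeight_nonneg hr hrR.le (mem_closedBall_zero_iff.1 ((mem_poles hf).1 hu).1)
  have hone : ∀ u, 0 ≤ 1 + Real.posLog (r / ‖z - u‖) := fun u ↦
    add_nonneg zero_le_one posLog_nonneg
  have hterm : ∀ u ∈ poles f R, ENNReal.ofReal (poleWeight f r R u) *
      (1 + ENNReal.ofReal (Real.posLog (r / ‖z - u‖))) =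
        ENNReal.ofReal (poleWeight f r R u * (1 + Real.posLog (r / ‖z - u‖))) := fun u hu ↦ by
    rw [ENNReal.ofReal_mul (hweight u hu), ENNReal.ofReal_add zero_le_one posLog_nonneg,
      ENNReal.ofReal_one]
  have hterm_nonneg : ∀ u ∈ poles f R,
      0 ≤ poleWeight f r R u * (1 + Real.posLog (r / ‖z - u‖)) :=
    fun u hu ↦ mul_nonneg (hweight u hu) (hone u)
  have hregular : ¬meromorphicOrderAt f z < 0 := fun h ↦
    hz' ((mem_poles hf).2 ⟨closedBall_subset_closedBall hrR.le hz, h⟩)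
  rw [logPlusAbs, if_neg hregular, Finset.sum_congr rfl hterm,
    ← ENNReal.ofReal_sum_of_nonneg hterm_nonneg, ← ENNReal.ofReal_add
      (circleAverage_nonneg_of_nonneg fun _ _ ↦ posLog_nonneg) (Finset.sum_nonneg hterm_nonneg),
    ← ENNReal.ofReal_mul hK]
  exact ENNReal.ofReal_le_ofReal (posLog_norm_le_sum_poleWeight hr hrR hf hz hz')

lemma ofReal_nevanlinnaT_sub_poleCounting (hr : 0 < r) (hrR : r ≤ R)
    (hf : MeromorphicOn f (closedBall 0 R)) :
    ENNReal.ofReal (nevanlinnaT R f - poleCounting r f) =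
      ENNReal.ofReal (circleAverage (Real.posLog ‖f ·‖) 0 R) +
        ∑ u ∈ poles f R, ENNReal.ofReal (poleWeight f r R u) := by
  have hweight : ∀ u ∈ poles f R, 0 ≤ poleWeight f r R u := fun u hu ↦
    poleWeight_nonneg hr hrR (mem_closedBall_zero_iff.1 ((mem_poles hf).1 hu).1)
  rw [nevanlinnaT_sub_poleCounting hr hrR hf, ENNReal.ofReal_add
      (circleAverage_nonneg_of_nonneg fun _ _ ↦ posLog_nonneg) (Finset.sum_nonneg hweight),
    ENNReal.ofReal_sum_of_nonneg hweight]

theorem lintegral_logPlusAbs_le {μ : Measure ℂ} [SFinite μ] (hr : 0 < r) (hrR : r < R)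
    (hf : MeromorphicOn f (closedBall 0 R)) (hμ : μ (poles f R) = 0) :
    ∫⁻ z in closedBall 0 r, logPlusAbs f z ∂μ ≤
      ENNReal.ofReal (5 * ((R + r) / (R - r)) * (nevanlinnaT R f - poleCounting r f)) *
        (μ (closedBall 0 r) + ⨆ z ∈ closedBall (0 : ℂ) R, measureCounting μ z r) := by
  set K := 5 * ((R + r) / (R - r))
  set m := circleAverage (Real.posLog ‖f ·‖) 0 R
  set A := closedBall (0 : ℂ) r
  set S := ⨆ z ∈ closedBall (0 : ℂ) R, measureCounting μ z r
  have hK : 0 ≤ K := mul_nonneg (by norm_num) (div_nonneg (by linarith) (by linarith))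
  have hpole : ∀ u ∈ poles f R,
      ∫⁻ z in A, (1 + ENNReal.ofReal (Real.posLog (r / ‖z - u‖))) ∂μ ≤ μ A + S := fun u hu ↦
    (setLIntegral_one_add_posLog_le μ A u hr).trans <| by
      gcongr
      exact le_biSup (fun z ↦ measureCounting μ z r) ((mem_poles hf).1 hu).1
  have hmeas : ∀ u : ℂ, Measurable fun z ↦ 1 + ENNReal.ofReal (Real.posLog (r / ‖z - u‖)) :=
    fun u ↦ measurable_const.add <| ENNReal.measurable_ofReal.comp <|
      continuous_posLog.measurable.comp (by fun_prop)
  calc ∫⁻ z in A, logPlusAbs f z ∂μ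
      ≤ ∫⁻ z in A, ENNReal.ofReal K * (ENNReal.ofReal m + ∑ u ∈ poles f R,
          ENNReal.ofReal (poleWeight f r R u) *
            (1 + ENNReal.ofReal (Real.posLog (r / ‖z - u‖)))) ∂μ := by
        refine lintegral_mono_ae ?_
        filter_upwards [ae_restrict_mem measurableSet_closedBall,
          ae_restrict_of_ae (measure_eq_zero_iff_ae_notMem.1 hμ)] with z hz hz'
        exact logPlusAbs_le_sum_poleWeight hr hrR hf hz hz'
    _ = ENNReal.ofReal K * (ENNReal.ofReal m * μ A + ∑ u ∈ poles f R,
          ENNReal.ofReal (poleWeight f r R u) *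
            ∫⁻ z in A, (1 + ENNReal.ofReal (Real.posLog (r / ‖z - u‖))) ∂μ) := by
        rw [lintegral_const_mul' _ _ ENNReal.ofReal_ne_top, lintegral_add_left measurable_const,
          setLIntegral_const, lintegral_finsetSum _ fun u _ ↦ (hmeas u).const_mul _]
        simp only [lintegral_const_mul' _ _ ENNReal.ofReal_ne_top]
    _ ≤ ENNReal.ofReal K * (ENNReal.ofReal m * (μ A + S) + ∑ u ∈ poles f R,
          ENNReal.ofReal (poleWeight f r R u) * (μ A + S)) := by
        gcongr with u hu
        · exact le_self_add
        · exact hpole u hu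
    _ = ENNReal.ofReal (K * (nevanlinnaT R f - poleCounting r f)) * (μ A + S) := by
        rw [ENNReal.ofReal_mul hK, ofReal_nevanlinnaT_sub_poleCounting hr hrR.le hf,
          ← Finset.sum_mul, ← add_mul, mul_assoc]

lemma poleCounting_const (c : ℂ) (s : ℝ) : poleCounting s (fun _ ↦ c) = 0 := by
  have hmult : ∀ z, poleMultiplicity (fun _ ↦ c) z = 0 := fun z ↦
    poleMultiplicity_eq_zero (AnalyticAt.meromorphicOrderAt_nonneg analyticAt_const)
  simp [poleCounting, poleCount, hmult]

lemma nevanlinnaT_const (c : ℂ) (s : ℝ) : nevanlinnaT s (fun _ ↦ c) = Real.posLog ‖c‖ := by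
  rw [nevanlinnaT, poleCounting_const, circleAverage_const, add_zero]

end LogPlusAbs

end Nevanlinna

end

theorem mainTheorem2 (r : ℝ) (hr : 0 < r) (μ : MeasureTheory.Measure ℂ)
    (hμ : μ (Metric.closedBall (0 : ℂ) r)ᶜ = 0) :
    (∃ r₀ : ℝ, 0 < r₀ ∧ ∃ R : ℝ, r < R ∧
      (⨆ z ∈ Metric.closedBall (0 : ℂ) R, Nevanlinna.measureCounting μ z r₀) < ∞) ↔
    (∀ R : ℝ, r < R → ∀ f : ℂ → ℂ, MeromorphicOn f (Metric.closedBall (0 : ℂ) R) →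
      AEMeasurable (Nevanlinna.logPlusAbs f) (μ.restrict (Metric.closedBall (0 : ℂ) r)) ∧
      (∫⁻ z in Metric.closedBall (0 : ℂ) r, Nevanlinna.logPlusAbs f z ∂μ) < ∞ ∧
      (∫⁻ z in Metric.closedBall (0 : ℂ) r, Nevanlinna.logPlusAbs f z ∂μ) ≤
        ENNReal.ofReal
          (5 * ((R + r) / (R - r)) * (Nevanlinna.nevanlinnaT R f - Nevanlinna.poleCounting r f)) *
        (μ (Metric.closedBall (0 : ℂ) r) +
          ⨆ z ∈ Metric.closedBall (0 : ℂ) R, Nevanlinna.measureCounting μ z r) ∧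
      ENNReal.ofReal
          (5 * ((R + r) / (R - r)) * (Nevanlinna.nevanlinnaT R f - Nevanlinna.poleCounting r f)) *
        (μ (Metric.closedBall (0 : ℂ) r) +
          ⨆ z ∈ Metric.closedBall (0 : ℂ) R, Nevanlinna.measureCounting μ z r) < ∞) := by
  constructor
  · rintro ⟨r₀, hr₀, R₀, hrR₀, hsup₀⟩ R hrR f hf
    have : IsFiniteMeasure μ := Nevanlinna.isFiniteMeasure_of_measureCounting_lt_top
      (isCompact_closedBall 0 r) hμ hr₀ fun z hz ↦
        (le_biSup (fun z ↦ Nevanlinna.measureCounting μ z r₀)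
          (closedBall_subset_closedBall hrR₀.le hz)).trans_lt hsup₀
    have hsup := Nevanlinna.iSup_measureCounting_lt_top hr₀ hrR₀ hμ hsup₀ r
    have hpoles : μ (Nevanlinna.poles f R) = 0 :=
      (measure_null_iff_singleton (Finset.countable_toSet _)).2 fun z _ ↦
        Nevanlinna.measure_singleton_eq_zero_of_measureCounting_lt_top hr
          ((le_iSup (fun z ↦ Nevanlinna.measureCounting μ z r) z).trans_lt hsup)
    have hle := Nevanlinna.lintegral_logPlusAbs_le hr hrR hf hpoles
    have hlt := ENNReal.mul_lt_top (ENNReal.ofReal_lt_top (r := 5 * ((R + r) / (R - r)) *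
        (Nevanlinna.nevanlinnaT R f - Nevanlinna.poleCounting r f)))
      (ENNReal.add_lt_top.2 ⟨measure_lt_top μ (closedBall 0 r),
        (iSup₂_le_iSup (· ∈ closedBall (0 : ℂ) R) _).trans_lt hsup⟩)
    exact ⟨Nevanlinna.aemeasurable_logPlusAbs
      (hf.mono_set (closedBall_subset_closedBall hrR.le)) μ, hle.trans_lt hlt, hle, hlt⟩
  · intro h
    have hlt := (h (r + 1) (lt_add_one r) (fun _ ↦ Real.exp 1) fun z _ ↦ .const _ z).2.2.2
    rw [Nevanlinna.nevanlinnaT_const, Nevanlinna.poleCounting_const, Complex.norm_real,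
      Real.norm_of_nonneg (Real.exp_pos 1).le, Real.posLog_apply, Real.log_exp,
      max_eq_right zero_le_one, add_sub_cancel_left, div_one, sub_zero, mul_one] at hlt
    have hfactor : ENNReal.ofReal (5 * (r + 1 + r)) ≠ 0 := by positivity
    exact ⟨r, hr, r + 1, lt_add_one r,
      (ENNReal.add_lt_top.1 (ENNReal.lt_top_of_mul_ne_top_right hlt.ne hfactor)).2⟩
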